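/- A compactological set is a set $X$ together with a non-empty collection $\mathscr{C}$ of subsets of $X$ and, for each $K\in\mathscr{C}$, a compact Hausdorff topology $\tau_K$ on $K$, such that: (1) $\bigcup_{K\in\mathscr{C}}K=X$; (2) for all $K_1,K_2\in\mathscr{C}$ there is $K_3\in\mathscr{C}$ with $K_1\cup K_2\subseteq K_3$; (3) if $K_1,K_2\in\mathscr{C}$ and $K_2\subseteq K_1$, then $\tau_{K_2}=\tau_{K_1}|_{K_2}$; (4) if $K_1\in\mathscr{C}$ and $K_2\subseteq(K_1,\tau_{K_1})$ is compact, then $K_2\in\mathscr{C}$. Let $\mathrm{Cmp}$ be the category of compactological sets, whose morphisms $(X,\mathscr{C},(\tau_K))\to(X',\mathscr{C}',(\tau'_{K'}))$ are the maps $f\colon X\to X'$ such that, for all $K\in\mathscr{C}$, $f(K)\in\mathscr{C}'$ and $f|_K\colon(K,\tau_K)\to(f(K),\tau'_{f(K)})$ is continuous. For an uncountable strong limit cardinal $\kappa$ let $\mathrm{Cmp}_\kappa$ be the full subcategory of those compactological sets for which $|K|<\kappa$ for all $K\in\mathscr{C}$. Let $\mathrm{CGWH}$ be the category of compactly generated weak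 Hausdorff spaces and continuous maps: spaces $X$ such that $f(S)\subseteq X$ is closed for every continuous map $f\colon S\to X$ from a compact Hausdorff space $S$, and such that a subset $F\subseteq X$ is closed if and only if $f^{-1}(F)$ is closed for all such $f$. Let $\iota\colon\mathrm{CGWH}\to\mathrm{Cmp}$ be the functor that endows a space with the collection of all its compact Hausdorff subspaces, each with the induced topology, and is the identity on underlying maps. Then, for every uncountable strong limit cardinal $\kappa$, the category $\mathrm{Cmp}_\kappa$ is cartesian closed, and $\mathrm{Cmp}$ is cartesian closed. Moreover $\mathrm{CGWH}$ is cartesian closed and $\iota$ preserves its internal homs: $\iota$ preserves binary products, and for all $X,Y\in\mathrm{CGWH}$ the canonical comparison morphism $\iota([X,Y])\to[\iota(X),\iota(Y)]$ is an isomorphism. -/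

import Mathlib

open CategoryTheory Limits
open scoped Cardinal

universe v w w' u

/-- A compactology on a set `X`: a non-empty collection `plain` of subsets of `X`, each endowed with
a compact Hausdorff topology, which covers `X`, is upwards filtering, has coherent topologies, and is
stable under compact subsets. -/
structure Compactology (X : Type u) where
  /-- the collection of subsets -/
  plain : Set (Set X)
  /-- the topology on each member of the collection -/
  top : (K : plain) → TopologicalSpace (K : Set X)
  nonempty : plain.Nonempty
  compact : ∀ K : plain, @CompactSpace (K : Set X) (top K)
  hausdorff : ∀ K : plain, @T2Space (K : Set X) (top K)
  covering : ⋃₀ plain = Set.univ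
  filtering : ∀ K₁ ∈ plain, ∀ K₂ ∈ plain, ∃ K₃ ∈ plain, K₁ ⊆ K₃ ∧ K₂ ⊆ K₃
  coherent : ∀ (K₁ K₂ : plain) (h : (K₂ : Set X) ⊆ K₁),
    top K₂ = (top K₁).induced (Set.inclusion h)
  stable : ∀ (K₁ : plain) (L : Set (K₁ : Set X)),
    @IsCompact (K₁ : Set X) (top K₁) L → Subtype.val '' L ∈ plain

/-- A compactological set. -/
structure Cmp : Type (u + 1) where
  /-- the underlying set -/
  carrier : Type u
  /-- the compactology -/
  str : Compactology carrier

namespace Cmp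

/-- A morphism of compactological sets: a map `f` which sends each `K` of the compactology to a
member `f(K)` of the compactology, such that `f|_K : K → f(K)` is continuous. -/
@[ext]
structure Hom (C D : Cmp.{u}) where
  /-- the underlying map -/
  toFun : C.carrier → D.carrier
  image_mem : ∀ K ∈ C.str.plain, toFun '' K ∈ D.str.plain
  continuous_restrict : ∀ (K : Set C.carrier) (hK : K ∈ C.str.plain),
    @Continuous K (toFun '' K : Set D.carrier) (C.str.top ⟨K, hK⟩)
      (D.str.top ⟨toFun '' K, image_mem K hK⟩)
      ((Set.mapsTo_image toFun K).restrict toFun K (toFun '' K))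

lemma Hom.continuous_restrict_of_eq {C D : Cmp.{u}} (f : Hom C D) (K : Set C.carrier)
    (hK : K ∈ C.str.plain) (L : Set D.carrier) (hL : L ∈ D.str.plain) (h : f.toFun '' K = L)
    (hm : Set.MapsTo f.toFun K L) :
    @Continuous K L (C.str.top ⟨K, hK⟩) (D.str.top ⟨L, hL⟩) (hm.restrict f.toFun K L) := by
  subst h
  exact f.continuous_restrict K hK

/-- The identity morphism. -/
def Hom.id (C : Cmp.{u}) : Hom C C where
  toFun := fun x => x
  image_mem := fun K hK => by simpa using hK
  continuous_restrict := fun K hK => by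
    have key : ∀ (L : Set C.carrier) (hL : L ∈ C.str.plain) (_ : K = L)
        (hm : Set.MapsTo (fun x => x) K L),
        @Continuous K L (C.str.top ⟨K, hK⟩) (C.str.top ⟨L, hL⟩)
          (hm.restrict (fun x => x) K L) := by
      intro L hL h hm
      subst h
      exact @continuous_id _ (C.str.top ⟨K, hK⟩)
    exact key _ _ (Set.image_id' K).symm _

/-- The composition of morphisms. -/
def Hom.comp {C D E : Cmp.{u}} (f : Hom C D) (g : Hom D E) : Hom C E where
  toFun := fun x => g.toFun (f.toFun x)
  image_mem := fun K hK => by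
    have := g.image_mem _ (f.image_mem K hK)
    rwa [Set.image_image] at this
  continuous_restrict := fun K hK => by
    have hE : (fun x => g.toFun (f.toFun x)) '' K ∈ E.str.plain := by
      have := g.image_mem _ (f.image_mem K hK)
      rwa [Set.image_image] at this
    have h1 := f.continuous_restrict K hK
    have h2 := g.continuous_restrict_of_eq (f.toFun '' K) (f.image_mem K hK)
      ((fun x => g.toFun (f.toFun x)) '' K) hE (Set.image_image _ _ _)
      (by rintro _ ⟨x, hx, rfl⟩; exact ⟨x, hx, rfl⟩)
    exact @Continuous.comp _ _ _ (C.str.top ⟨K, hK⟩) (D.str.top ⟨_, f.image_mem K hK⟩)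
      (E.str.top ⟨_, hE⟩) _ _ h2 h1

/-- The category of compactological sets. -/
instance : Category.{u} Cmp.{u} where
  Hom := Hom
  id := Hom.id
  comp := Hom.comp

end Cmp

/-- The category of `κ`-compactological sets: the full subcategory of the compactological sets all of
whose plain sets have cardinality less than `κ`. -/
abbrev CmpCard (κ : Cardinal.{u}) : Type (u + 1) :=
  ObjectProperty.FullSubcategory (fun C : Cmp.{u} => ∀ K ∈ C.str.plain, #K < κ)

/-- A space is weak Hausdorff if every continuous map from a compact Hausdorff space to it has a
closed range. -/
def IsWeakHausdorff (X : Type u) [TopologicalSpace X] : Prop :=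
  ∀ (S : Type u) [TopologicalSpace S] [CompactSpace S] [T2Space S] (f : S → X),
    Continuous f → IsClosed (Set.range f)

/-- The category of compactly generated weak Hausdorff spaces and continuous maps. -/
abbrev CGWH : Type (u + 1) :=
  ObjectProperty.FullSubcategory
    (fun X : TopCat.{u} => CompactlyGeneratedSpace X ∧ IsWeakHausdorff X)

namespace IsWeakHausdorff

variable {X : Type u} [TopologicalSpace X]

lemma t2Space_range (hX : IsWeakHausdorff X) {S : Type u} [TopologicalSpace S] [CompactSpace S]
    [T2Space S] {f : S → X} (hf : Continuous f) : T2Space (Set.range f) := by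
  have hpt : ∀ x : X, IsClosed ({x} : Set X) := fun x => by
    have := hX PUnit.{u + 1} (fun _ => x) continuous_const
    simpa using this
  have hcl : ∀ A : Set S, IsClosed A → IsClosed (f '' A) := fun A hA => by
    have : CompactSpace A := isCompact_iff_compactSpace.1 hA.isCompact
    have := hX A (fun a => f a) (hf.comp continuous_subtype_val)
    rwa [← Set.image_eq_range] at this
  refine ⟨?_⟩
  rintro ⟨x, hx⟩ ⟨y, hy⟩ hxy
  have hne : x ≠ y := fun h => hxy (Subtype.ext h)
  obtain ⟨U, V, hU, hV, hxU, hyV, hUV⟩ := SeparatedNhds.of_isCompact_isCompact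
    ((hpt x).preimage hf).isCompact ((hpt y).preimage hf).isCompact
    (Set.disjoint_left.2 fun s hs ht => hne (hs.symm.trans ht))
  refine ⟨Subtype.val ⁻¹' (f '' Uᶜ)ᶜ, Subtype.val ⁻¹' (f '' Vᶜ)ᶜ,
    (hcl _ hU.isClosed_compl).isOpen_compl.preimage continuous_subtype_val,
    (hcl _ hV.isClosed_compl).isOpen_compl.preimage continuous_subtype_val, ?_, ?_, ?_⟩
  · rintro ⟨s, hs, h⟩
    exact hs (hxU h)
  · rintro ⟨s, hs, h⟩
    exact hs (hyV h)
  · refine Set.disjoint_left.2 ?_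
    rintro ⟨_, s, rfl⟩ h1 h2
    have hsU : s ∈ U := by
      by_contra h
      exact h1 ⟨s, h, rfl⟩
    have hsV : s ∈ V := by
      by_contra h
      exact h2 ⟨s, h, rfl⟩
    exact (hUV.le_bot ⟨hsU, hsV⟩).elim

lemma compact_t2_image (hX : IsWeakHausdorff X) {S : Type u} [TopologicalSpace S] {f : S → X}
    (hf : Continuous f) (K : Set S) (hK : CompactSpace K ∧ T2Space K) :
    CompactSpace (f '' K : Set X) ∧ T2Space (f '' K : Set X) := by
  obtain ⟨h1, h2⟩ := hK
  have hc : Continuous fun a : K => f a := hf.comp continuous_subtype_val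
  have := hX.t2Space_range hc
  rw [← Set.image_eq_range] at this
  exact ⟨isCompact_iff_compactSpace.1 ((isCompact_iff_compactSpace.2 h1).image hf), this⟩

/-- The compactology of all compact Hausdorff subspaces of a weak Hausdorff space, each with the
induced topology. -/
def compactology (hX : IsWeakHausdorff X) : Compactology X where
  plain := {K | CompactSpace K ∧ T2Space K}
  top := fun _ => inferInstance
  nonempty := ⟨∅, inferInstance, inferInstance⟩
  compact := fun K => K.2.1
  hausdorff := fun K => K.2.2
  covering := Set.eq_univ_of_forall fun x =>
    ⟨{x}, ⟨inferInstance, inferInstance⟩, rfl⟩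
  filtering := by
    rintro K₁ ⟨_, _⟩ K₂ ⟨_, _⟩
    refine ⟨K₁ ∪ K₂, ⟨?_, ?_⟩, Set.subset_union_left, Set.subset_union_right⟩
    · exact isCompact_iff_compactSpace.1
        ((isCompact_iff_compactSpace.2 ‹_›).union (isCompact_iff_compactSpace.2 ‹_›))
    · have hf : Continuous (Sum.elim Subtype.val Subtype.val : K₁ ⊕ K₂ → X) :=
        continuous_subtype_val.sumElim continuous_subtype_val
      have := hX.t2Space_range hf
      rwa [Set.Sum.elim_range, Subtype.range_coe, Subtype.range_coe] at this
  coherent := fun K₁ K₂ h => by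
    exact (induced_compose (f := Set.inclusion h) (g := Subtype.val)).symm
  stable := by
    rintro ⟨K, hK, hK'⟩ L hL
    refine ⟨isCompact_iff_compactSpace.1 (hL.image continuous_subtype_val), ?_⟩
    exact T2Space.of_injective_continuous
      (f := Set.inclusion (show Subtype.val '' L ⊆ K by rintro _ ⟨x, _, rfl⟩; exact x.2))
      (Set.inclusion_injective _) (continuous_inclusion _)

end IsWeakHausdorff

namespace CGWH

/-- The inclusion of compactly generated weak Hausdorff spaces into compactological sets. It endows a
space with the compactology of all its compact Hausdorff subspaces, and is the identity on maps. -/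
def toCmp : CGWH.{u} ⥤ Cmp.{u} where
  obj X := ⟨X.obj, X.property.2.compactology⟩
  map {X Y} f :=
    { toFun := f.hom
      image_mem := fun K hK => Y.property.2.compact_t2_image f.hom.hom.continuous K hK
      continuous_restrict := fun K _ =>
        f.hom.hom.continuous.restrict (Set.mapsTo_image _ K) }

end CGWH

/-- A category is cartesian closed if it has finite products and every functor `A × -` has a right
adjoint (the internal hom `[A, -]`). -/
def IsCartesianClosed (C : Type w) [Category.{v} C] : Prop :=
  ∃ _ : CartesianMonoidalCategory C, Nonempty (MonoidalClosed C)

/-- A functor between cartesian closed categories preserves internal homs if it preserves binary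
products and the canonical comparison `F[A, B] ⟶ [FA, FB]`, the transpose of
`FA × F[A, B] ≅ F(A × [A, B]) ⟶ FB`, is an isomorphism for all `A` and `B`. This does not depend on
the chosen products and internal homs; it is required for all choices. -/
def PreservesInternalHoms {C : Type w} [Category.{v} C] {D : Type w'} [Category.{v} D]
    (F : C ⥤ D) : Prop :=
  ∀ [CartesianMonoidalCategory C] [CartesianMonoidalCategory D]
    [MonoidalClosed C] [MonoidalClosed D],
    ∃ _ : PreservesLimitsOfShape (Discrete WalkingPair) F, MonoidalClosedFunctor F

/-! ### Categorical criteria for internal homs and their preservation -/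

section CartesianClosedCriteria

open MonoidalCategory CartesianMonoidalCategory

/-! A compactological set carries the finest topology making the inclusions of its plain sets
continuous, and each plain set gets its own topology back as a subspace
(`Compactology.top_eq_induced`). So all arguments take place on plain subsets of one ambient space.

The hom `Cmp.internalHom C D` lives on the set of morphisms. A plain set of morphisms is compact for
pointwise convergence, sends each plain `K` into one plain set, and has jointly continuous
evaluation on `K`; this makes evaluation a morphism. Transposes exist because joint continuity on `K
× S`, for `S` compact, descends to the image of `S` (`Cmp.range_mem_plainHom`).

Both full subcategories follow by `IsCartesianClosed.of_fullyFaithful`. With bounded cardinality,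
the hom is the coreflection `Cmp.restrictCard` of the hom in `Cmp`. For `CGWH`, the functor `toCmp`
is fully faithful and its essential image is the saturated objects: those in which continuous images
of compact Hausdorff spaces are plain. Saturation passes to products and to homs into a saturated
object.

The comparison `ι[X, Y] ⟶ [ιX, ιY]` is formally bijective on morphisms out of the image of `ι`
(`bijective_comp_expComparison`). That image contains the plain sets of every compactological set,
so such a morphism is an isomorphism (`CGWH.isIso_of_bijective_comp`). -/

/-- A monoidal category in which every `B` has a universal evaluation `A ⊗ E ⟶ B` is closed. -/
lemma nonempty_monoidalClosed {C : Type w} [Category.{v} C] [MonoidalCategory C]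
    (hE : ∀ A B : C, ∃ (E : C) (ev : A ⊗ E ⟶ B), ∀ (Z : C) (f : A ⊗ Z ⟶ B),
      ∃! g : Z ⟶ E, A ◁ g ≫ ev = f) :
    Nonempty (MonoidalClosed C) := by
  choose E ev hev using hE
  choose t ht huniq using hev
  refine ⟨⟨fun A => ?_⟩⟩
  let e : ∀ Z B : C, ((tensorLeft A).obj Z ⟶ B) ≃ (Z ⟶ E A B) := fun Z B =>
    { toFun := fun f => t A B Z f
      invFun := fun g => A ◁ g ≫ ev A B
      left_inv := fun f => ht A B Z f
      right_inv := fun g => (huniq A B Z _ g rfl).symm }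
  have he : ∀ X' X Y f g, e X' Y ((tensorLeft A).map f ≫ g) = f ≫ e X Y g := by
    intro X' X Y f g
    refine (huniq A Y X' _ _ ?_).symm
    have := ht A Y X g
    simp only [e, Equiv.coe_fn_mk, MonoidalCategory.whiskerLeft_comp, Category.assoc, this]
    rfl
  exact ⟨_, Adjunction.adjunctionOfEquivRight e he⟩

section FullyFaithful

variable {C : Type w} [Category.{v} C] {D : Type w'} [Category.{v} D] [CartesianMonoidalCategory D]
  (F : C ⥤ D) [F.Full] [F.Faithful]

/-- A fully faithful functor whose essential image is closed under binary products reflects them: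
for `F P ≅ F A ⊗ F B`, the object `P` is a product of `A` and `B`. -/
noncomputable def isLimitBinaryFanOfIso {A B P : C} (e : F.obj P ≅ F.obj A ⊗ F.obj B) :
    IsLimit (BinaryFan.mk (F.preimage (e.hom ≫ fst _ _)) (F.preimage (e.hom ≫ snd _ _))) :=
  BinaryFan.IsLimit.mk _
    (fun f g => F.preimage (lift (F.map f) (F.map g) ≫ e.inv))
    (fun f g => F.map_injective (by simp))
    (fun f g => F.map_injective (by simp))
    (fun f g m hf hg => F.map_injective (by
      rw [F.map_preimage, Iso.eq_comp_inv]
      ext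
      · simp [← hf]
      · simp [← hg]))

/-- The image of the product cone of `isLimitBinaryFanOfIso` is a product cone. -/
noncomputable def isLimitMapBinaryFanOfIso {A B P : C} (e : F.obj P ≅ F.obj A ⊗ F.obj B) :
    IsLimit (BinaryFan.mk (F.map (F.preimage (e.hom ≫ fst (F.obj A) (F.obj B))))
      (F.map (F.preimage (e.hom ≫ snd (F.obj A) (F.obj B))))) :=
  BinaryFan.IsLimit.mk _
    (fun f g => lift f g ≫ e.inv)
    (fun f g => by simp)
    (fun f g => by simp)
    (fun f g m hf hg => by
      rw [Iso.eq_comp_inv]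
      ext
      · simp [← hf]
      · simp [← hg])

/-- Preservation need only be checked on one limit cone, and the reflected product cone has a
product cone as image by construction. -/
lemma preservesBinaryProducts_of_iso
    (hP : ∀ A B : C, ∃ P : C, Nonempty (F.obj P ≅ F.obj A ⊗ F.obj B)) :
    PreservesLimitsOfShape (Discrete WalkingPair) F := by
  have : ∀ A B : C, PreservesLimit (pair A B) F := fun A B => by
    obtain ⟨P, ⟨e⟩⟩ := hP A B
    exact preservesLimit_of_preserves_limit_cone (isLimitBinaryFanOfIso F e)
      ((isLimitMapConeBinaryFanEquiv F _ _).symm (isLimitMapBinaryFanOfIso F e))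
  exact ⟨fun {K} => preservesLimit_of_iso_diagram F (diagramIsoPair K).symm⟩

/-- Let `F : C ⥤ D` be fully faithful. If the essential image of `F` is closed under finite products
and every pair `F A`, `F B` has an internal hom in the essential image which is universal with respect
to the objects of the image, then `C` is cartesian closed. -/
lemma IsCartesianClosed.of_fullyFaithful
    (hT : ∃ T : C, Nonempty (F.obj T ≅ 𝟙_ D))
    (hP : ∀ A B : C, ∃ P : C, Nonempty (F.obj P ≅ F.obj A ⊗ F.obj B))
    (hE : ∀ A B : C, ∃ (E : C) (ev : F.obj A ⊗ F.obj E ⟶ F.obj B),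
      ∀ (Z : C) (f : F.obj A ⊗ F.obj Z ⟶ F.obj B),
        ∃! g : F.obj Z ⟶ F.obj E, F.obj A ◁ g ≫ ev = f) :
    IsCartesianClosed C := by
  have hpres := preservesBinaryProducts_of_iso F hP
  obtain ⟨T, ⟨eT⟩⟩ := hT
  choose P eP using hP
  have hTerm : IsTerminal T := IsTerminal.ofUniqueHom
    (fun Z => F.preimage (toUnit _ ≫ eT.inv))
    (fun Z m => F.map_injective (by
      rw [F.map_preimage, Iso.eq_comp_inv]
      exact toUnit_unique _ _))
  let _ : CartesianMonoidalCategory C := .ofChosenFiniteProducts ⟨_, hTerm⟩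
    (fun A B => ⟨_, isLimitBinaryFanOfIso F (eP A B).some⟩)
  refine ⟨inferInstance, nonempty_monoidalClosed fun A B => ?_⟩
  obtain ⟨E, ev, hev⟩ := hE A B
  refine ⟨E, F.preimage (prodComparison F A E ≫ ev), fun Z f => ?_⟩
  -- Applying the faithful `F` and cancelling `prodComparison` turns the universal property in `C`
  -- into the one assumed in `D`.
  have key : ∀ g : Z ⟶ E, A ◁ g ≫ F.preimage (prodComparison F A E ≫ ev) = f ↔
      F.obj A ◁ F.map g ≫ ev = inv (CartesianMonoidalCategory.prodComparison F A Z) ≫ F.map f := by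
    intro g
    rw [← F.map_injective.eq_iff, F.map_comp, F.map_preimage,
      prodComparison_natural_whiskerLeft_assoc, IsIso.eq_inv_comp]
  obtain ⟨h, hh, huniq⟩ := hev Z (inv (CartesianMonoidalCategory.prodComparison F A Z) ≫ F.map f)
  refine ⟨F.preimage h, (key _).2 (by simpa using hh), fun g hg => F.map_injective ?_⟩
  rw [F.map_preimage]
  exact huniq _ ((key g).1 hg)

end FullyFaithful

/-- For a fully faithful functor preserving binary products, the comparison `F[A, B] ⟶ [F A, F B]`
induces bijections on morphisms out of the image of `F`. -/
lemma bijective_comp_expComparison {C : Type w} [Category.{v} C] {D : Type w'} [Category.{v} D]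
    [CartesianMonoidalCategory C] [CartesianMonoidalCategory D]
    [MonoidalClosed C] [MonoidalClosed D] (F : C ⥤ D) [F.Full] [F.Faithful]
    [PreservesLimitsOfShape (Discrete WalkingPair) F] (A B Z : C) :
    Function.Bijective (fun h : F.obj Z ⟶ F.obj ((ihom A).obj B) =>
      h ≫ (expComparison F A).natTrans.app B) := by
  -- Under this formula, composing with the comparison becomes a chain of bijections: uncurrying,
  -- `F` on morphisms, precomposition with an isomorphism, currying.
  have key : ∀ h : Z ⟶ (ihom A).obj B, F.map h ≫ (expComparison F A).natTrans.app B =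
      MonoidalClosed.curry (inv (CartesianMonoidalCategory.prodComparison F A Z) ≫ F.map (MonoidalClosed.uncurry h)) := by
    intro h
    rw [MonoidalClosed.eq_curry_iff, MonoidalClosed.uncurry_natural_left, uncurry_expComparison,
      MonoidalClosed.uncurry_eq, F.map_comp, prodComparison_inv_natural_whiskerLeft_assoc]
  constructor
  · intro h h' hh
    obtain ⟨h, rfl⟩ := F.map_surjective h
    obtain ⟨h', rfl⟩ := F.map_surjective h'
    simp only [key] at hh
    have := F.map_injective ((cancel_epi _).1 (MonoidalClosed.curry_injective hh))
    rw [MonoidalClosed.uncurry_injective this]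
  · intro g
    obtain ⟨f, hf⟩ := F.map_surjective (CartesianMonoidalCategory.prodComparison F A Z ≫
      MonoidalClosed.uncurry g)
    refine ⟨F.map (MonoidalClosed.curry f), ?_⟩
    simp only [key, MonoidalClosed.uncurry_curry, hf, IsIso.inv_hom_id_assoc,
      MonoidalClosed.curry_uncurry]

end CartesianClosedCriteria

/-! ### Continuity on subsets under a change of topology -/

open Topology

section Subspaces

variable {X Y Z : Type*}

lemma continuousOn_prod_iff_continuous_subtype [TopologicalSpace X] [TopologicalSpace Y]
    [TopologicalSpace Z] {f : X × Y → Z} {K : Set X} {H : Set Y} :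
    ContinuousOn f (K ×ˢ H) ↔ Continuous fun p : K × H => f (p.1, p.2) := by
  rw [continuousOn_iff_continuous_domRestrict, ← (Homeomorph.Set.prod K H).symm.comp_continuous_iff']
  rfl

/-- Continuity on `K` sees only the topology induced on `K`. On plain sets, this allows the
generated topology of a product or hom to be traded for the product or pointwise topology. -/
lemma continuousOn_congr_dom {t₁ t₂ : TopologicalSpace X} [TopologicalSpace Y] {K : Set X}
    (h : t₁.induced (Subtype.val : K → X) = t₂.induced Subtype.val) {f : X → Y} :
    @ContinuousOn X Y t₁ _ f K ↔ @ContinuousOn X Y t₂ _ f K := by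
  rw [@continuousOn_iff_continuous_domRestrict _ _ t₁, @continuousOn_iff_continuous_domRestrict _ _ t₂]
  change @Continuous K Y (t₁.induced _) _ _ ↔ @Continuous K Y (t₂.induced _) _ _
  rw [h]

lemma continuousOn_prod_congr_snd [TopologicalSpace X] {t₁ t₂ : TopologicalSpace Y}
    [TopologicalSpace Z] {K : Set X} {H : Set Y}
    (h : t₁.induced (Subtype.val : H → Y) = t₂.induced Subtype.val) {f : X × Y → Z} :
    @ContinuousOn _ _ (@instTopologicalSpaceProd X Y _ t₁) _ f (K ×ˢ H) ↔
      @ContinuousOn _ _ (@instTopologicalSpaceProd X Y _ t₂) _ f (K ×ˢ H) := by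
  rw [@continuousOn_prod_iff_continuous_subtype _ _ _ _ t₁,
    @continuousOn_prod_iff_continuous_subtype _ _ _ _ t₂]
  change @Continuous _ _ (@instTopologicalSpaceProd K H _ (t₁.induced _)) _ _ ↔
    @Continuous _ _ (@instTopologicalSpaceProd K H _ (t₂.induced _)) _ _
  rw [h]

lemma continuousOn_congr_cod {t₁ t₂ : TopologicalSpace Y} [TopologicalSpace X] {L : Set Y}
    (h : t₁.induced (Subtype.val : L → Y) = t₂.induced Subtype.val) {f : X → Y} {K : Set X}
    (hf : Set.MapsTo f K L) :
    @ContinuousOn X Y _ t₁ f K ↔ @ContinuousOn X Y _ t₂ f K := by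
  rw [@continuousOn_iff_continuous_domRestrict _ _ _ t₁, @continuousOn_iff_continuous_domRestrict _ _ _ t₂]
  have key : ∀ t : TopologicalSpace Y, @Continuous K Y _ t (K.domRestrict f) ↔
      @Continuous K L _ (t.induced Subtype.val) (hf.restrict f K L) := fun t => by
    rw [continuous_induced_rng]
    rfl
  rw [key, key, h]

end Subspaces

/-! ### The topology generated by a compactology -/

namespace Compactology

variable {X : Type u}

/-- The finest topology for which the inclusions of all members of the compactology are
continuous. -/
@[reducible]
def topology (c : Compactology X) : TopologicalSpace X :=
  ⨆ K : c.plain, (c.top K).coinduced Subtype.val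

lemma isClosed_topology_iff (c : Compactology X) {A : Set X} :
    IsClosed[c.topology] A ↔ ∀ K : c.plain, IsClosed[c.top K] (Subtype.val ⁻¹' A) := by
  simp only [isClosed_iSup_iff, isClosed_coinduced]

/-- To test against a plain `L`, choose a plain `M` containing both `K` and `L`: the compact set `A`
is closed in the Hausdorff space `M`, hence its trace on `L` is closed. -/
lemma isClosed_topology_image (c : Compactology X) (K : c.plain) {A : Set K}
    (hA : IsClosed[c.top K] A) : IsClosed[c.topology] (Subtype.val '' A : Set X) := by
  rw [isClosed_topology_iff]
  intro L
  obtain ⟨M, hM, hKM, hLM⟩ := c.filtering K K.2 L L.2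
  let _ := c.top K
  let _ := c.top L
  let _ := c.top ⟨M, hM⟩
  have := c.compact K
  have : T2Space M := c.hausdorff ⟨M, hM⟩
  have hK : Continuous (Set.inclusion hKM) :=
    continuous_iff_le_induced.2 (c.coherent ⟨M, hM⟩ K hKM).le
  have hL : Continuous (Set.inclusion hLM) :=
    continuous_iff_le_induced.2 (c.coherent ⟨M, hM⟩ L hLM).le
  convert! (hA.isCompact.image hK).isClosed.preimage hL
  ext ⟨x, hx⟩
  constructor
  · rintro ⟨a, ha, rfl⟩
    exact ⟨a, ha, rfl⟩
  · rintro ⟨a, ha, h⟩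
    exact ⟨a, ha, congrArg Subtype.val h⟩

lemma top_eq_induced (c : Compactology X) (K : c.plain) :
    c.top K = c.topology.induced Subtype.val := by
  let _ := c.top K
  let _ := c.topology
  have hc : Continuous (Subtype.val : K.1 → X) :=
    continuous_iff_coinduced_le.2 (le_iSup (fun K : c.plain => (c.top K).coinduced Subtype.val) K)
  exact (IsClosedEmbedding.of_continuous_injective_isClosedMap hc Subtype.val_injective
    fun A hA => c.isClosed_topology_image K hA).eq_induced

/-- The compactology given by a family of compact Hausdorff subspaces of a topological space. -/
def ofTopology [TopologicalSpace X] (P : Set (Set X)) (hne : P.Nonempty)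
    (hcomp : ∀ K ∈ P, IsCompact K) (ht2 : ∀ K ∈ P, T2Space K) (hcov : ∀ x, ∃ K ∈ P, x ∈ K)
    (hdir : ∀ K₁ ∈ P, ∀ K₂ ∈ P, ∃ K₃ ∈ P, K₁ ⊆ K₃ ∧ K₂ ⊆ K₃)
    (hst : ∀ K ∈ P, ∀ L ⊆ K, IsCompact L → L ∈ P) : Compactology X where
  plain := P
  top := fun _ => inferInstance
  nonempty := hne
  compact := fun K => isCompact_iff_compactSpace.1 (hcomp K K.2)
  hausdorff := fun K => ht2 K K.2
  covering := Set.eq_univ_of_forall hcov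
  filtering := hdir
  coherent := fun _ _ h => (induced_compose (f := Set.inclusion h) (g := Subtype.val)).symm
  stable := fun K _ hL => hst K K.2 _ (by rintro _ ⟨x, _, rfl⟩; exact x.2)
    (hL.image continuous_subtype_val)

end Compactology

namespace Cmp

instance (C : Cmp.{u}) : TopologicalSpace C.carrier := C.str.topology

section Plain

variable {C : Cmp.{u}} {K L : Set C.carrier}

lemma top_eq (hK : K ∈ C.str.plain) : C.str.top ⟨K, hK⟩ = instTopologicalSpaceSubtype :=
  C.str.top_eq_induced ⟨K, hK⟩

lemma compactSpace_of_mem (hK : K ∈ C.str.plain) : CompactSpace K := by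
  have := C.str.compact ⟨K, hK⟩
  rwa [top_eq] at this

lemma isCompact_of_mem (hK : K ∈ C.str.plain) : IsCompact K :=
  isCompact_iff_compactSpace.2 (compactSpace_of_mem hK)

lemma t2Space_of_mem (hK : K ∈ C.str.plain) : T2Space K := by
  have := C.str.hausdorff ⟨K, hK⟩
  rwa [top_eq] at this

lemma isClosed_of_mem (hK : K ∈ C.str.plain) : IsClosed K := by
  have := C.str.isClosed_topology_image ⟨K, hK⟩ (@isClosed_univ _ (C.str.top _))
  rwa [Set.image_univ, Subtype.range_coe] at this

lemma mem_of_isCompact (hK : K ∈ C.str.plain) (hL : IsCompact L) (h : L ⊆ K) :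
    L ∈ C.str.plain := by
  have := C.str.stable ⟨K, hK⟩ (Subtype.val ⁻¹' L) (by
    rw [top_eq, Subtype.isCompact_iff, Subtype.image_preimage_coe, Set.inter_eq_right.2 h]
    exact hL)
  rwa [Subtype.image_preimage_coe, Set.inter_eq_right.2 h] at this

lemma exists_mem (x : C.carrier) : ∃ K ∈ C.str.plain, x ∈ K := by
  have : x ∈ ⋃₀ C.str.plain := C.str.covering ▸ Set.mem_univ x
  exact this

lemma singleton_mem (x : C.carrier) : {x} ∈ C.str.plain := by
  obtain ⟨K, hK, hx⟩ := exists_mem x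
  exact mem_of_isCompact hK isCompact_singleton (Set.singleton_subset_iff.2 hx)

lemma union_mem (hK : K ∈ C.str.plain) (hL : L ∈ C.str.plain) : K ∪ L ∈ C.str.plain := by
  obtain ⟨M, hM, h1, h2⟩ := C.str.filtering K hK L hL
  exact mem_of_isCompact hM ((isCompact_of_mem hK).union (isCompact_of_mem hL))
    (Set.union_subset h1 h2)

lemma isClosed_iff {A : Set C.carrier} :
    IsClosed A ↔ ∀ K ∈ C.str.plain, IsClosed (Subtype.val ⁻¹' A : Set K) := by
  refine C.str.isClosed_topology_iff.trans ⟨fun h K hK => ?_, fun h K => ?_⟩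
  · rw [← top_eq hK]
    exact h ⟨K, hK⟩
  · rw [top_eq K.2]
    exact h K K.2

lemma continuous_iff {Y : Type*} [TopologicalSpace Y] {f : C.carrier → Y} :
    Continuous f ↔ ∀ K ∈ C.str.plain, ContinuousOn f K := by
  refine ⟨fun h K _ => h.continuousOn, fun h => continuous_iff_isClosed.2 fun A hA => ?_⟩
  exact isClosed_iff.2 fun K hK => hA.preimage (h K hK).domRestrict

end Plain

namespace Hom

variable {C D : Cmp.{u}}

lemma continuousOn (f : Hom C D) {K : Set C.carrier} (hK : K ∈ C.str.plain) :
    ContinuousOn f.toFun K := by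
  have := f.continuous_restrict K hK
  rw [top_eq, top_eq] at this
  exact continuousOn_iff_continuous_domRestrict.2 (continuous_subtype_val.comp this)

lemma continuous (f : Hom C D) : Continuous f.toFun :=
  continuous_iff.2 fun _ => f.continuousOn

/-- A map is a morphism if it is continuous on each plain set, with values in a plain set. -/
def ofContinuousOn (f : C.carrier → D.carrier)
    (hf : ∀ K ∈ C.str.plain, ContinuousOn f K ∧ ∃ L ∈ D.str.plain, Set.MapsTo f K L) :
    Hom C D where
  toFun := f
  image_mem := fun K hK => by
    obtain ⟨h, L, hL, hKL⟩ := hf K hK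
    exact mem_of_isCompact hL ((isCompact_of_mem hK).image_of_continuousOn h) hKL.image_subset
  continuous_restrict := fun K hK => by
    rw [top_eq, top_eq]
    exact (hf K hK).1.mapsToRestrict _

end Hom

@[ext]
lemma hom_ext {C D : Cmp.{u}} {f g : C ⟶ D} (h : ∀ x, Hom.toFun f x = Hom.toFun g x) : f = g :=
  Hom.ext (funext h)

section OfTopology

variable {X : Type u} [TopologicalSpace X] {c : Compactology X}

/-- The members of the compactology carry the subspace topology of the given topology. -/
def _root_.Compactology.IsCompatible (c : Compactology X) : Prop :=
  ∀ K : c.plain, c.top K = instTopologicalSpaceSubtype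

lemma _root_.Compactology.IsCompatible.topology_le (hc : c.IsCompatible) :
    c.topology ≤ ‹TopologicalSpace X› := by
  refine iSup_le fun K => ?_
  rw [hc K]
  exact continuous_iff_coinduced_le.1 continuous_subtype_val

lemma _root_.Compactology.IsCompatible.induced_eq (hc : c.IsCompatible) {K : Set X}
    (hK : K ∈ c.plain) :
    c.topology.induced (Subtype.val : K → X) = instTopologicalSpaceSubtype :=
  (c.top_eq_induced ⟨K, hK⟩).symm.trans (hc ⟨K, hK⟩)

end OfTopology

/-! ### Finite products of compactological sets -/

/-- The product of two compactological sets: the plain sets are the compact subsets of the products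
`K × L` of plain sets. -/
def prod (C D : Cmp.{u}) : Cmp.{u} where
  carrier := C.carrier × D.carrier
  str := .ofTopology
    {H | IsCompact H ∧ ∃ K ∈ C.str.plain, ∃ L ∈ D.str.plain, H ⊆ K ×ˢ L}
    (by
      obtain ⟨K, hK⟩ := C.str.nonempty
      obtain ⟨L, hL⟩ := D.str.nonempty
      exact ⟨_, (isCompact_of_mem hK).prod (isCompact_of_mem hL), K, hK, L, hL, subset_rfl⟩)
    (fun _ hH => hH.1)
    (by
      rintro H ⟨-, K, hK, L, hL, hHKL⟩
      have := t2Space_of_mem hK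
      have := t2Space_of_mem hL
      refine T2Space.of_injective_continuous
        (f := fun p : H => ((⟨p.1.1, (hHKL p.2).1⟩, ⟨p.1.2, (hHKL p.2).2⟩) : K × L)) ?_ ?_
      · intro p q h
        simp only [Prod.mk.injEq, Subtype.mk.injEq] at h
        exact Subtype.ext (Prod.ext h.1 h.2)
      · fun_prop)
    (fun x => ⟨{x}, ⟨isCompact_singleton, {x.1}, singleton_mem _, {x.2}, singleton_mem _,
      by simp⟩, rfl⟩)
    (by
      rintro H₁ ⟨h₁, K₁, hK₁, L₁, hL₁, hs₁⟩ H₂ ⟨h₂, K₂, hK₂, L₂, hL₂, hs₂⟩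
      exact ⟨H₁ ∪ H₂, ⟨h₁.union h₂, K₁ ∪ K₂, union_mem hK₁ hK₂, L₁ ∪ L₂, union_mem hL₁ hL₂,
        Set.union_subset
          (hs₁.trans (Set.prod_mono Set.subset_union_left Set.subset_union_left))
          (hs₂.trans (Set.prod_mono Set.subset_union_right Set.subset_union_right))⟩,
        Set.subset_union_left, Set.subset_union_right⟩)
    (fun _ ⟨_, K, hK, L, hL, hs⟩ _ h hc => ⟨hc, K, hK, L, hL, h.trans hs⟩)

section Prod

variable {C D E : Cmp.{u}}

lemma prod_isCompatible : (prod C D).str.IsCompatible (X := C.carrier × D.carrier) :=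
  fun _ => rfl

lemma prod_mem {K : Set C.carrier} {L : Set D.carrier} (hK : K ∈ C.str.plain)
    (hL : L ∈ D.str.plain) : (K ×ˢ L : Set (C.carrier × D.carrier)) ∈ (prod C D).str.plain :=
  ⟨(isCompact_of_mem hK).prod (isCompact_of_mem hL), K, hK, L, hL, subset_rfl⟩

/-- A map out of a product is a morphism if it is continuous on products of plain sets, with values
in a plain set. -/
def prodElim (f : C.carrier × D.carrier → E.carrier)
    (hf : ∀ K ∈ C.str.plain, ∀ L ∈ D.str.plain, ContinuousOn f (K ×ˢ L) ∧
      ∃ M ∈ E.str.plain, Set.MapsTo f (K ×ˢ L) M) : prod C D ⟶ E :=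
  Hom.ofContinuousOn f (by
    rintro H hH
    obtain ⟨-, K, hK, L, hL, hs⟩ := id hH
    obtain ⟨h, M, hM, hm⟩ := hf K hK L hL
    exact ⟨(continuousOn_congr_dom (prod_isCompatible.induced_eq hH)).2 (h.mono hs),
      M, hM, hm.mono_left hs⟩)

lemma continuousOn_prod (f : prod C D ⟶ E) {K : Set C.carrier} {L : Set D.carrier}
    (hK : K ∈ C.str.plain) (hL : L ∈ D.str.plain) :
    ContinuousOn (X := C.carrier × D.carrier) (Hom.toFun f) (K ×ˢ L) :=
  (continuousOn_congr_dom (prod_isCompatible.induced_eq (prod_mem hK hL))).1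
    (Hom.continuousOn f (prod_mem hK hL))

/-- The first projection. -/
def prodFst (C D : Cmp.{u}) : prod C D ⟶ C :=
  prodElim Prod.fst fun K hK _ _ => ⟨continuous_fst.continuousOn, K, hK, fun _ h => h.1⟩

/-- The second projection. -/
def prodSnd (C D : Cmp.{u}) : prod C D ⟶ D :=
  prodElim Prod.snd fun _ _ L hL => ⟨continuous_snd.continuousOn, L, hL, fun _ h => h.2⟩

/-- The morphism into a product given by its components. -/
def prodLift (f : E ⟶ C) (g : E ⟶ D) : E ⟶ prod C D :=
  Hom.ofContinuousOn (D := prod C D) (fun x => (Hom.toFun f x, Hom.toFun g x)) (by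
    intro K hK
    have hm : Set.MapsTo (fun x => (Hom.toFun f x, Hom.toFun g x)) K
        ((Hom.toFun f '' K) ×ˢ (Hom.toFun g '' K)) :=
      fun x hx => ⟨⟨x, hx, rfl⟩, ⟨x, hx, rfl⟩⟩
    have hp := prod_mem (Hom.image_mem f K hK) (Hom.image_mem g K hK)
    exact ⟨(continuousOn_congr_cod (prod_isCompatible.induced_eq hp) hm).2
      ((Hom.continuousOn f hK).prodMk (Hom.continuousOn g hK)), _, hp, hm⟩)

/-- The product of compactological sets is a categorical product. -/
def isLimitProd (C D : Cmp.{u}) : IsLimit (BinaryFan.mk (prodFst C D) (prodSnd C D)) :=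
  BinaryFan.IsLimit.mk _ (fun f g => prodLift f g) (fun _ _ => rfl) (fun _ _ => rfl)
    (fun _ _ _ hf hg => hom_ext fun x => Prod.ext
      (congrArg (fun k => Hom.toFun k x) hf) (congrArg (fun k => Hom.toFun k x) hg))

end Prod

/-- The one-point compactological set. -/
def point : Cmp.{u} where
  carrier := PUnit
  str := .ofTopology Set.univ ⟨∅, trivial⟩ (fun K _ => K.toFinite.isCompact)
    (fun _ _ => inferInstance) (fun _ => ⟨Set.univ, trivial, trivial⟩)
    (fun _ _ _ _ => ⟨Set.univ, trivial, Set.subset_univ _, Set.subset_univ _⟩)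
    (fun _ _ _ _ _ => trivial)

/-- The one-point compactological set is terminal. -/
def isTerminalPoint : IsTerminal point.{u} :=
  IsTerminal.ofUniqueHom
    (fun _ => Hom.ofContinuousOn (fun _ => PUnit.unit)
      fun _ _ => ⟨continuousOn_const, Set.univ, trivial, fun _ _ => trivial⟩)
    (fun _ _ => rfl)

instance : CartesianMonoidalCategory Cmp.{u} :=
  .ofChosenFiniteProducts ⟨_, isTerminalPoint⟩ fun C D => ⟨_, isLimitProd C D⟩

/-! ### The internal hom of compactological sets -/

section InternalHom

/-- The topology of pointwise convergence on a set of morphisms. -/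
instance pointwiseTopology (C D : Cmp.{u}) : TopologicalSpace (Hom C D) :=
  .induced Hom.toFun inferInstance

variable {C D E : Cmp.{u}}

lemma continuous_eval (x : C.carrier) : Continuous fun f : Hom C D => f.toFun x :=
  (continuous_apply x).comp continuous_induced_dom

/-- `D` itself is not assumed Hausdorff. Distinct morphisms differ at some `x`, and boundedness on
`{x}` puts all values at `x` in one plain set, which is Hausdorff. -/
lemma t2Space_of_bounded {H : Set (Hom C D)}
    (hH : ∀ K ∈ C.str.plain, ∃ L ∈ D.str.plain, ∀ f ∈ H, Set.MapsTo f.toFun K L) :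
    T2Space H := by
  refine ⟨fun f g hfg => ?_⟩
  obtain ⟨x, hx⟩ : ∃ x, f.1.toFun x ≠ g.1.toFun x := by
    by_contra! h
    exact hfg (Subtype.ext (Hom.ext (funext h)))
  obtain ⟨L, hL, hm⟩ := hH {x} (singleton_mem x)
  have := t2Space_of_mem hL
  exact separated_by_continuous (f := fun h : H => (⟨h.1.toFun x, hm h h.2 rfl⟩ : L))
    (((continuous_eval x).comp continuous_subtype_val).subtype_mk _)
    fun h => hx (congrArg Subtype.val h)

/-- The sets of morphisms which are compact for pointwise convergence, map each plain set into a
plain set, and on which the evaluation is jointly continuous on plain sets. -/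
def plainHom (C D : Cmp.{u}) : Set (Set (Hom C D)) :=
  {H | IsCompact H ∧ ∀ K ∈ C.str.plain,
    ContinuousOn (fun p : C.carrier × Hom C D => p.2.toFun p.1) (K ×ˢ H) ∧
      ∃ L ∈ D.str.plain, ∀ f ∈ H, Set.MapsTo f.toFun K L}

lemma range_mem_plainHom {S : Type*} [TopologicalSpace S] [CompactSpace S] (f : S → Hom C D)
    (hf : ∀ K ∈ C.str.plain, (Continuous fun p : K × S => (f p.2).toFun p.1) ∧
      ∃ L ∈ D.str.plain, ∀ s, Set.MapsTo (f s).toFun K L) :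
    Set.range f ∈ plainHom C D := by
  have hcont : Continuous f := by
    refine continuous_induced_rng.2 (continuous_pi fun x => ?_)
    exact (hf {x} (singleton_mem x)).1.comp
      (continuous_const (y := (⟨x, rfl⟩ : ({x} : Set C.carrier))) |>.prodMk continuous_id)
  have hb : ∀ K ∈ C.str.plain, ∃ L ∈ D.str.plain,
      ∀ g ∈ Set.range f, Set.MapsTo g.toFun K L := fun K hK => by
    obtain ⟨-, L, hL, hm⟩ := hf K hK
    exact ⟨L, hL, by rintro _ ⟨s, rfl⟩; exact hm s⟩
  refine ⟨isCompact_range hcont, fun K hK => ⟨?_, hb K hK⟩⟩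
  have := t2Space_of_bounded hb
  have := t2Space_of_mem hK
  have := compactSpace_of_mem hK
  -- A continuous surjection from a compact space onto a Hausdorff space is a quotient map, so joint
  -- continuity may be tested on `K × S`.
  have hq : IsQuotientMap (Prod.map id (Set.rangeFactorization f) : K × S → K × Set.range f) :=
    IsQuotientMap.of_surjective_continuous
      (Function.surjective_id.prodMap Set.rangeFactorization_surjective)
      (continuous_id.prodMap hcont.rangeFactorization)
  rw [continuousOn_prod_iff_continuous_subtype, hq.continuous_iff]
  exact (hf K hK).1

/-- The internal hom of compactological sets. -/
def internalHom (C D : Cmp.{u}) : Cmp.{u} where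
  carrier := Hom C D
  str := .ofTopology (plainHom C D)
    ⟨∅, isCompact_empty, fun K _ => ⟨by simp, by
      obtain ⟨L, hL⟩ := D.str.nonempty
      exact ⟨L, hL, by simp⟩⟩⟩
    (fun _ hH => hH.1)
    (fun H hH => t2Space_of_bounded fun K hK => (hH.2 K hK).2)
    (fun f => by
      refine ⟨_, range_mem_plainHom (fun _ : Unit => f) fun K hK => ⟨?_, ?_⟩, ⟨(), rfl⟩⟩
      · exact (f.continuousOn hK).domRestrict.comp continuous_fst
      · exact ⟨_, f.image_mem K hK, fun _ => Set.mapsTo_image _ _⟩)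
    (by
      intro H₁ h₁ H₂ h₂
      have := isCompact_iff_compactSpace.1 h₁.1
      have := isCompact_iff_compactSpace.1 h₂.1
      -- The union is the range of `H₁ ⊕ H₂`, on which joint continuity splits into the two
      -- summands.
      refine ⟨_, range_mem_plainHom (Sum.elim Subtype.val Subtype.val : H₁ ⊕ H₂ → Hom C D)
        fun K hK => ⟨?_, ?_⟩, fun f hf => ⟨.inl ⟨f, hf⟩, rfl⟩, fun f hf => ⟨.inr ⟨f, hf⟩, rfl⟩⟩
      · rw [← Homeomorph.prodSumDistrib.symm.comp_continuous_iff', continuous_sum_dom]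
        exact ⟨continuousOn_prod_iff_continuous_subtype.1 (h₁.2 K hK).1,
          continuousOn_prod_iff_continuous_subtype.1 (h₂.2 K hK).1⟩
      · obtain ⟨-, L₁, hL₁, hm₁⟩ := h₁.2 K hK
        obtain ⟨-, L₂, hL₂, hm₂⟩ := h₂.2 K hK
        refine ⟨L₁ ∪ L₂, union_mem hL₁ hL₂, ?_⟩
        rintro (f | f) x hx
        · exact Or.inl (hm₁ f f.2 hx)
        · exact Or.inr (hm₂ f f.2 hx))
    (fun H hH L hLH hL => ⟨hL, fun K hK => ⟨(hH.2 K hK).1.mono (Set.prod_mono_right hLH), by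
      obtain ⟨-, M, hM, hm⟩ := hH.2 K hK
      exact ⟨M, hM, fun f hf => hm f (hLH hf)⟩⟩⟩)

lemma internalHom_isCompatible : (internalHom C D).str.IsCompatible (X := Hom C D) :=
  fun _ => rfl

/-- The evaluation morphism. -/
def eval (C D : Cmp.{u}) : prod C (internalHom C D) ⟶ D :=
  prodElim (D := internalHom C D) (fun p => Hom.toFun (C := C) (D := D) p.2 p.1) (by
    intro K hK H hH
    obtain ⟨hc, L, hL, hm⟩ := hH.2 K hK
    exact ⟨(continuousOn_prod_congr_snd (internalHom_isCompatible.induced_eq hH)).2 hc,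
      L, hL, fun p hp => hm p.2 hp.2 hp.1⟩)

/-- The morphism `C ⟶ D` obtained from `C × E ⟶ D` by fixing a point of `E`. -/
def fixSnd (f : prod C E ⟶ D) (z : E.carrier) : Hom C D :=
  Hom.ofContinuousOn (fun x => Hom.toFun f (x, z)) fun _ hK =>
    ⟨(continuousOn_prod f hK (singleton_mem z)).comp
      (continuous_id.prodMk continuous_const).continuousOn fun _ hx => ⟨hx, rfl⟩,
      _, Hom.image_mem f _ (prod_mem hK (singleton_mem z)), fun x hx => ⟨(x, z), ⟨hx, rfl⟩, rfl⟩⟩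

/-- The transpose of a morphism out of a product. -/
def curry (f : prod C E ⟶ D) : E ⟶ internalHom C D :=
  Hom.ofContinuousOn (D := internalHom C D) (fun z => fixSnd f z) (by
    intro Q hQ
    have := compactSpace_of_mem hQ
    have hr : Set.range (fun z : Q => fixSnd f z) ∈ plainHom C D := by
      refine range_mem_plainHom _ fun K hK => ⟨?_, ?_⟩
      · exact continuousOn_prod_iff_continuous_subtype.1 (continuousOn_prod f hK hQ)
      · exact ⟨_, Hom.image_mem f _ (prod_mem hK hQ), fun z x hx => ⟨(x, z.1), ⟨hx, z.2⟩, rfl⟩⟩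
    have hm : Set.MapsTo (fun z => fixSnd f z) Q (Set.range (fun z : Q => fixSnd f z)) :=
      fun z hz => ⟨⟨z, hz⟩, rfl⟩
    -- On the plain set just found, the generated topology is that of pointwise convergence, so
    -- continuity is checked at each `x`.
    refine ⟨(continuousOn_congr_cod (internalHom_isCompatible.induced_eq hr) hm).2 ?_, _, hr, hm⟩
    rw [continuousOn_iff_continuous_domRestrict]
    refine continuous_induced_rng.2 (continuous_pi fun x => ?_)
    exact continuousOn_iff_continuous_domRestrict.1
      ((continuousOn_prod f (singleton_mem x) hQ).comp
        (continuous_const.prodMk continuous_id).continuousOn fun z hz => ⟨rfl, hz⟩))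

open MonoidalCategory in
/-- Let `ε : E ⟶ [C, D]` be such that every morphism `Z ⟶ [C, D]` factors uniquely through `ε`. Then
the evaluation of `E` is universal for `Z`. -/
lemma existsUnique_transpose {Z : Cmp.{u}} (ε : E ⟶ internalHom C D)
    (hε : ∀ g : Z ⟶ internalHom C D, ∃! h : Z ⟶ E, h ≫ ε = g) (f : C ⊗ Z ⟶ D) :
    ∃! g : Z ⟶ E, C ◁ g ≫ C ◁ ε ≫ (eval C D : C ⊗ internalHom C D ⟶ D) = f := by
  obtain ⟨h, hh, huniq⟩ := hε (curry f)
  refine ⟨h, ?_, fun g hg => huniq g ?_⟩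
  · simp only [← MonoidalCategory.whiskerLeft_comp_assoc, hh]
    rfl
  · subst hg
    rfl

end InternalHom

lemma isCartesianClosed : IsCartesianClosed Cmp.{u} :=
  ⟨inferInstance, nonempty_monoidalClosed fun C D =>
    ⟨_, _, fun _ => existsUnique_transpose (𝟙 (internalHom C D)) fun g =>
      ⟨g, Category.comp_id g, fun h hh => by simpa using hh⟩⟩⟩

/-! ### Plain sets of bounded cardinality -/

/-- The compactological set with the same points as `C` whose plain sets are those of cardinality
less than `κ`. -/
def restrictCard (C : Cmp.{u}) (κ : Cardinal.{u}) (hκ : ℵ₀ ≤ κ) : Cmp.{u} where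
  carrier := C.carrier
  str :=
    { plain := {K | K ∈ C.str.plain ∧ #K < κ}
      top := fun K => C.str.top ⟨K, K.2.1⟩
      nonempty := by
        obtain ⟨K, hK⟩ := C.str.nonempty
        exact ⟨∅, mem_of_isCompact hK isCompact_empty (Set.empty_subset _), by
          simpa using Cardinal.aleph0_pos.trans_le hκ⟩
      compact := fun K => C.str.compact ⟨K, K.2.1⟩
      hausdorff := fun K => C.str.hausdorff ⟨K, K.2.1⟩
      covering := Set.eq_univ_of_forall fun x => ⟨{x}, ⟨singleton_mem x, by
        simpa using Cardinal.one_lt_aleph0.trans_le hκ⟩, rfl⟩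
      filtering := fun K hK L hL => ⟨K ∪ L, ⟨union_mem hK.1 hL.1,
        (Cardinal.mk_union_le K L).trans_lt (Cardinal.add_lt_of_lt hκ hK.2 hL.2)⟩,
        Set.subset_union_left, Set.subset_union_right⟩
      coherent := fun K₁ K₂ h => C.str.coherent ⟨K₁, K₁.2.1⟩ ⟨K₂, K₂.2.1⟩ h
      stable := fun K L hL => ⟨C.str.stable ⟨K, K.2.1⟩ L hL,
        Cardinal.mk_image_le.trans_lt ((Cardinal.mk_set_le L).trans_lt K.2.2)⟩ }

/-- The canonical morphism from the restriction to plain sets of bounded cardinality. -/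
def restrictCardCounit (C : Cmp.{u}) (κ : Cardinal.{u}) (hκ : ℵ₀ ≤ κ) :
    restrictCard C κ hκ ⟶ C where
  toFun := fun x => x
  image_mem := fun K hK => (Hom.id C).image_mem K hK.1
  continuous_restrict := fun K hK => (Hom.id C).continuous_restrict K hK.1

/-- Images of sets of size less than `κ` again have size less than `κ`, so restriction is a
coreflection. -/
lemma existsUnique_comp_restrictCardCounit {C Z : Cmp.{u}} {κ : Cardinal.{u}} (hκ : ℵ₀ ≤ κ)
    (hZ : ∀ K ∈ Z.str.plain, #K < κ) (g : Z ⟶ C) :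
    ∃! h : Z ⟶ restrictCard C κ hκ, h ≫ restrictCardCounit C κ hκ = g := by
  refine ⟨Hom.mk (C := Z) (D := restrictCard C κ hκ) (Hom.toFun (D := C) g) (fun K hK => ⟨Hom.image_mem g K hK,
    Cardinal.mk_image_le.trans_lt (hZ K hK)⟩) (Hom.continuous_restrict g), rfl, fun h hh => ?_⟩
  subst hh
  rfl

lemma mk_lt_of_mem_prod {C D : Cmp.{u}} {κ : Cardinal.{u}} (hκ : ℵ₀ ≤ κ)
    (hC : ∀ K ∈ C.str.plain, #K < κ) (hD : ∀ K ∈ D.str.plain, #K < κ) :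
    ∀ K ∈ (prod C D).str.plain, #K < κ := by
  rintro H ⟨-, K, hK, L, hL, hs⟩
  refine (Cardinal.mk_le_mk_of_subset hs).trans_lt ((Cardinal.mk_setProd K L).trans_lt ?_)
  exact Cardinal.mul_lt_of_lt hκ (by simpa using hC K hK) (by simpa using hD L hL)

end Cmp

lemma CmpCard.isCartesianClosed {κ : Cardinal.{u}} (hκ : ℵ₀ ≤ κ) :
    IsCartesianClosed (CmpCard κ) := by
  refine .of_fullyFaithful (ObjectProperty.ι _) ⟨⟨Cmp.point, fun K _ => ?_⟩, ⟨Iso.refl _⟩⟩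
    (fun A B => ⟨⟨Cmp.prod A.obj B.obj, Cmp.mk_lt_of_mem_prod hκ A.property B.property⟩,
      ⟨Iso.refl _⟩⟩)
    (fun A B => ⟨⟨Cmp.restrictCard (Cmp.internalHom A.obj B.obj) κ hκ, fun K hK => hK.2⟩, _,
      fun Z => Cmp.existsUnique_transpose (Cmp.restrictCardCounit _ κ hκ)
        (Cmp.existsUnique_comp_restrictCardCounit hκ Z.property)⟩)
  exact (Cardinal.mk_lt_aleph0_iff.2 (Set.toFinite (α := PUnit) K)).trans_le hκ

/-! ### Saturation, and recovering a space from its compactology -/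

namespace Cmp

/-- A compactological set is saturated if every continuous map from a compact Hausdorff space has a
plain range. -/
def IsSaturated (C : Cmp.{u}) : Prop :=
  ∀ (S : Type u) [TopologicalSpace S] [CompactSpace S] [T2Space S] (f : S → C.carrier),
    Continuous f → Set.range f ∈ C.str.plain

lemma isSaturated_point : IsSaturated point.{u} := fun _ _ _ _ _ _ => trivial

variable {C D : Cmp.{u}}

lemma IsSaturated.prod (hC : C.IsSaturated) (hD : D.IsSaturated) : (prod C D).IsSaturated := by
  intro S _ _ _ f hf
  refine mem_of_isCompact (prod_mem (hC S _ ((Hom.continuous (prodFst C D)).comp hf))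
    (hD S _ ((Hom.continuous (prodSnd C D)).comp hf))) (isCompact_range hf) ?_
  rintro _ ⟨s, rfl⟩
  exact ⟨⟨s, rfl⟩, ⟨s, rfl⟩⟩

/-- Restriction to a plain set is continuous into the compact-open topology. -/
lemma continuous_restrict_internalHom {K : Set C.carrier} (hK : K ∈ C.str.plain) :
    Continuous (X := (internalHom C D).carrier) (Y := C(K, D.carrier)) fun f : Hom C D =>
      (⟨K.domRestrict f.toFun, (f.continuousOn hK).domRestrict⟩ : C(K, D.carrier)) := by
  refine (continuous_iff (C := internalHom C D)).2 fun H hH => ?_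
  refine (continuousOn_congr_dom (internalHom_isCompatible.induced_eq hH)).2 ?_
  refine (continuousOn_iff_continuous_domRestrict (α := Hom C D)).2 ?_
  refine ContinuousMap.continuous_of_continuous_uncurry _ ?_
  exact (continuousOn_prod_iff_continuous_subtype.1 (hH.2 K hK).1).comp continuous_swap

/-- Restricting to a plain `K` gives a continuous map `S → C(K, D)`, which uncurries since `K` is
compact. The range of `K × S` in `D` is plain by saturation and bounds the whole family on `K`. -/
lemma IsSaturated.internalHom (hD : D.IsSaturated) : (internalHom C D).IsSaturated := by
  intro S _ _ _ f hf
  refine range_mem_plainHom f fun K hK => ?_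
  have := compactSpace_of_mem hK
  have := t2Space_of_mem hK
  have hc : Continuous fun p : K × S => Hom.toFun (C := C) (D := D) (f p.2) p.1 :=
    (ContinuousMap.continuous_uncurry_of_continuous
      ⟨_, (continuous_restrict_internalHom hK).comp hf⟩).comp continuous_swap
  exact ⟨hc, _, hD _ _ hc, fun s x hx => ⟨(⟨x, hx⟩, s), rfl⟩⟩

end Cmp

/-- A test map from a compact Hausdorff space has plain range, where both topologies agree; compact
generation then makes the identity continuous into the generated topology. -/
lemma IsWeakHausdorff.topology_compactology {X : Type u} [t : TopologicalSpace X]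
    [CompactlyGeneratedSpace X] (hX : IsWeakHausdorff X) : hX.compactology.topology = t := by
  have hc : hX.compactology.IsCompatible := fun _ => rfl
  refine le_antisymm hc.topology_le (continuous_id_iff_le.1 ?_)
  refine @continuous_from_compactlyGeneratedSpace X X _ hX.compactology.topology _ _
    fun S _ _ _ g hg => ?_
  have hr : Set.range g ∈ hX.compactology.plain :=
    ⟨isCompact_iff_compactSpace.1 (isCompact_range hg), hX.t2Space_range hg⟩
  rw [← @continuousOn_univ _ _ _ hX.compactology.topology]
  exact (continuousOn_congr_cod (hc.induced_eq hr) fun s _ => Set.mem_range_self s).2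
    hg.continuousOn

/-! ### Compactly generated weak Hausdorff spaces as saturated compactological sets -/

namespace CGWH

lemma topology_toCmp (X : CGWH.{u}) : (toCmp.obj X).str.topology = X.obj.str := by
  have := X.property.1
  exact X.property.2.topology_compactology

instance : toCmp.{u}.Faithful where
  map_injective {_ _} f g h := by
    ext x
    exact congrArg (fun k => Cmp.Hom.toFun k x) h

instance : toCmp.{u}.Full where
  map_surjective {X Y} g := by
    have hg : @Continuous _ _ (toCmp.obj X).str.topology (toCmp.obj Y).str.topology
        (Cmp.Hom.toFun g) := Cmp.Hom.continuous g
    rw [topology_toCmp, topology_toCmp] at hg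
    exact ⟨⟨TopCat.ofHom ⟨_, hg⟩⟩, rfl⟩

lemma isSaturated_toCmp (X : CGWH.{u}) : (toCmp.obj X).IsSaturated := by
  intro S _ _ _ f hf
  have hf' : @Continuous _ _ _ (toCmp.obj X).str.topology f := hf
  rw [topology_toCmp] at hf'
  exact ⟨isCompact_iff_compactSpace.1 (isCompact_range hf'), X.property.2.t2Space_range hf'⟩

/-- The compactly generated weak Hausdorff space underlying a saturated compactological set. -/
def ofIsSaturated {C : Cmp.{u}} (hC : C.IsSaturated) : CGWH.{u} where
  obj := TopCat.of C.carrier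
  property := by
    refine ⟨compactlyGeneratedSpace_of_isClosed fun A hA => Cmp.isClosed_iff.2 fun K hK => ?_,
      fun S _ _ _ f hf => Cmp.isClosed_of_mem (hC S f hf)⟩
    have := Cmp.compactSpace_of_mem hK
    have := Cmp.t2Space_of_mem hK
    exact hA K _ continuous_subtype_val

/-- The morphism to a compactological set given by a continuous map with plain images. -/
def homOfContinuous {X : CGWH.{u}} {C : Cmp.{u}} (f : X.obj → C.carrier) (hf : Continuous f)
    (hp : ∀ K : Set X.obj, CompactSpace K → T2Space K → f '' K ∈ C.str.plain) :
    toCmp.obj X ⟶ C :=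
  Cmp.Hom.ofContinuousOn (C := toCmp.obj X) f fun K hK => by
    have hf' : @Continuous _ _ (toCmp.obj X).str.topology _ f := by
      rw [topology_toCmp]
      exact hf
    exact ⟨hf'.continuousOn, _, hp K hK.1 hK.2, Set.mapsTo_image _ _⟩

/-- A saturated compactological set is isomorphic to the one given by its underlying space. -/
def toCmpOfIsSaturatedIso {C : Cmp.{u}} (hC : C.IsSaturated) :
    toCmp.obj (ofIsSaturated hC) ≅ C where
  hom := homOfContinuous (X := ofIsSaturated hC) (fun x : C.carrier => x) continuous_id
    fun (K : Set C.carrier) hK hK' => by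
      have : CompactSpace K := hK
      have : T2Space K := hK'
      have := hC K Subtype.val continuous_subtype_val
      rw [Subtype.range_coe] at this
      exact (Set.image_id' K).symm ▸ this
  inv := Cmp.Hom.ofContinuousOn (D := toCmp.obj (ofIsSaturated hC)) (fun x => x) fun K hK => by
    refine ⟨?_, K, ⟨Cmp.compactSpace_of_mem hK, Cmp.t2Space_of_mem hK⟩, fun _ h => h⟩
    have : @Continuous _ _ _ (toCmp.obj (ofIsSaturated hC)).str.topology
        (fun x : C.carrier => x) := by
      rw [topology_toCmp]
      exact continuous_id
    exact this.continuousOn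
  hom_inv_id := rfl
  inv_hom_id := rfl

open MonoidalCategory in
lemma exists_toCmp_iso_tensor (X Y : CGWH.{u}) :
    ∃ P : CGWH.{u}, Nonempty (toCmp.obj P ≅ toCmp.obj X ⊗ toCmp.obj Y) :=
  ⟨_, ⟨toCmpOfIsSaturatedIso ((isSaturated_toCmp X).prod (isSaturated_toCmp Y))⟩⟩

lemma isCartesianClosed : IsCartesianClosed CGWH.{u} := by
  refine .of_fullyFaithful toCmp ⟨_, ⟨toCmpOfIsSaturatedIso Cmp.isSaturated_point⟩⟩
    exists_toCmp_iso_tensor fun X Y => ?_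
  let e := toCmpOfIsSaturatedIso ((isSaturated_toCmp Y).internalHom (C := toCmp.obj X))
  exact ⟨_, _, fun Z => Cmp.existsUnique_transpose e.hom fun g =>
    ⟨g ≫ e.inv, by simp, fun h hh => by simp [← hh]⟩⟩

/-! ### Detecting isomorphisms by compact Hausdorff spaces -/

/-- A compact Hausdorff space as a compactly generated weak Hausdorff space. -/
def ofCompact (S : Type u) [TopologicalSpace S] [CompactSpace S] [T2Space S] : CGWH.{u} where
  obj := TopCat.of S
  property := ⟨inferInstanceAs (CompactlyGeneratedSpace S),
    fun _ _ _ _ _ hf => (isCompact_range hf).isClosed⟩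

/-- The inclusion of a plain set. -/
def plainInclusion {C : Cmp.{u}} {K : Set C.carrier} (hK : K ∈ C.str.plain) :
    haveI := Cmp.compactSpace_of_mem hK
    haveI := Cmp.t2Space_of_mem hK
    toCmp.obj (ofCompact K) ⟶ C :=
  haveI := Cmp.compactSpace_of_mem hK
  haveI := Cmp.t2Space_of_mem hK
  homOfContinuous (X := ofCompact K) (Subtype.val : K → C.carrier) continuous_subtype_val
    fun L hL _ => Cmp.mem_of_isCompact hK
      ((isCompact_iff_compactSpace.2 hL).image (continuous_subtype_val (p := (· ∈ K))))
      (by rintro _ ⟨x, _, rfl⟩; exact x.2)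

/-- The image of `toCmp` detects isomorphisms of compactological sets. -/
lemma isIso_of_bijective_comp {C D : Cmp.{u}} (c : C ⟶ D)
    (hc : ∀ Z : CGWH.{u}, Function.Bijective fun h : toCmp.obj Z ⟶ C => h ≫ c) : IsIso c := by
  -- Points of `C` are morphisms from the one-point space.
  have hinj : Function.Injective (Cmp.Hom.toFun c) := by
    intro x y hxy
    let k : ∀ z : C.carrier, toCmp.obj (ofCompact PUnit.{u + 1}) ⟶ C := fun z =>
      homOfContinuous (X := ofCompact PUnit.{u + 1}) (fun _ : PUnit.{u + 1} => z) continuous_const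
        fun K _ _ => Cmp.mem_of_isCompact (Cmp.singleton_mem z)
          ((isCompact_iff_compactSpace.2 ‹_›).image continuous_const) (by rintro _ ⟨_, _, rfl⟩; rfl)
    have : k x = k y := (hc _).1 (Cmp.hom_ext fun _ => hxy)
    exact congrArg (fun h => Cmp.Hom.toFun h PUnit.unit) this
  -- Lifting the inclusion of a plain `L` through `c` gives the inverse of `c` on `L`, already
  -- continuous and with plain range.
  have hlift : ∀ (L : Set D.carrier), L ∈ D.str.plain → ∃ h : L → C.carrier, Continuous h ∧
      Set.range h ∈ C.str.plain ∧ ∀ x, Cmp.Hom.toFun c (h x) = x := by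
    intro L hL
    have := Cmp.compactSpace_of_mem hL
    have := Cmp.t2Space_of_mem hL
    obtain ⟨h, hh⟩ := (hc (ofCompact L)).2 (plainInclusion hL)
    have hcont : @Continuous _ _ (toCmp.obj (ofCompact L)).str.topology _ (Cmp.Hom.toFun h) :=
      Cmp.Hom.continuous h
    rw [topology_toCmp] at hcont
    refine ⟨Cmp.Hom.toFun h, hcont, ?_, fun x =>
      congrArg (fun k : toCmp.obj (ofCompact L) ⟶ D => Cmp.Hom.toFun k x) hh⟩
    have := Cmp.Hom.image_mem h _ (isSaturated_toCmp (ofCompact L) L (fun x => x) (by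
      change @Continuous _ _ _ (toCmp.obj (ofCompact L)).str.topology _
      rw [topology_toCmp]
      exact continuous_id))
    exact (Set.range_comp (Cmp.Hom.toFun h) fun x => x).symm ▸ this
  have hsurj : Function.Surjective (Cmp.Hom.toFun c) := fun y => by
    obtain ⟨h, -, -, hh⟩ := hlift {y} (Cmp.singleton_mem y)
    exact ⟨_, hh ⟨y, rfl⟩⟩
  let e := Equiv.ofBijective _ ⟨hinj, hsurj⟩
  let d : D ⟶ C := Cmp.Hom.ofContinuousOn e.symm fun L hL => by
    obtain ⟨h, hcont, hr, hh⟩ := hlift L hL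
    have heq : ∀ x : L, e.symm x = h x := fun x => e.symm_apply_eq.2 (hh x).symm
    refine ⟨?_, _, hr, fun x hx => ⟨⟨x, hx⟩, (heq _).symm⟩⟩
    rw [continuousOn_iff_continuous_domRestrict]
    exact hcont.congr fun x => (heq x).symm
  exact ⟨d, Cmp.hom_ext e.symm_apply_apply, Cmp.hom_ext e.apply_symm_apply⟩

lemma preservesInternalHoms_toCmp : PreservesInternalHoms toCmp.{u} := by
  have hp := preservesBinaryProducts_of_iso toCmp.{u} exists_toCmp_iso_tensor
  intro _ _ _ _
  refine ⟨hp, ⟨fun A => ?_⟩⟩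
  have : ∀ B, IsIso ((expComparison toCmp.{u} A).natTrans.app B) := fun B =>
    isIso_of_bijective_comp _ fun Z => bijective_comp_expComparison toCmp A B Z
  exact NatIso.isIso_of_isIso_app _

end CGWH

theorem mainTheorem7 :
    (∀ κ : Cardinal.{u}, ℵ₀ < κ → κ.IsStrongLimit → IsCartesianClosed (CmpCard κ)) ∧
    IsCartesianClosed Cmp.{u} ∧
    IsCartesianClosed CGWH.{u} ∧
    PreservesInternalHoms CGWH.toCmp.{u} :=
  ⟨fun _ hκ _ => CmpCard.isCartesianClosed hκ.le, Cmp.isCartesianClosed, CGWH.isCartesianClosed,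
    CGWH.preservesInternalHoms_toCmp⟩
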